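/- Let $k$ be a countable field and $G$ a countable archimedean ordered abelian group with $G\neq\{0\}$. Let $k((G))$ be the field of (generalized) power series with well-ordered support, coefficients in $k$ and exponents in $G$, with its canonical valuation $v$ (the least exponent in the support). Let $k(G)$ be the smallest subfield of $k((G))$ containing all monomials $ct^g$ ($c\in k$, $g\in G$), and let $k(G)^c$ be its completion, realized as the topological closure of $k(G)$ in $k((G))$. Let $k[G^{<0}]$ be the (non-unital) subring of $k(G)$ generated by all monomials $ct^g$ with $c\in k$ and $0>g\in G$. Subrings that are additive complements are not required to contain $1$: a subring $R$ of a valued field $(K,v)$ with valuation ring $\mathcal O$ is an additive complement of $\mathcal O$ if $R\cap\mathcal O=\{0\}$ and $R+\mathcal O=K$. For a subring $R$ of a field, $\operatorname{Quot} R$ denotes the subfield generated by $R$. An integer part of an ordered field $K$ is a subring $I$ with $1$, having no element strictly between $0$ and $1$, such that for all $a\in K$ there is $r\in I$ with $r\le a<r+1$. Then: 1. $k(G)^c$ is complete, $k(G)$ is dense in it, and $k(G)^c$ is an uncountable henselian valued field. 2. The ring $k[G^{<0}]$ is countable and is an additive complement of the valuation ring of $k(G)^c$. 3. If $R$ is any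 subring of $k(G)^c$ which is an additive complement of the valuation ring of $k(G)^c$, then $\operatorname{Quot} R$ is countable and the transcendence degree of $k(G)^c$ over $\operatorname{Quot} R$ is uncountable. 4. If in addition $k$ is an ordered field, $k(G)^c$ is equipped with any field ordering that extends the ordering of $k$ and is compatible with $v$ (that is, $0<x\le y$ implies $v(x)\ge v(y)$; for instance the ordering in which the sign of a nonzero series is that of its leading coefficient), and $I$ is an integer part of this ordered field, then $\operatorname{Quot} I$ is countable and the transcendence degree of $k(G)^c$ over $\operatorname{Quot} I$ is uncountable. -/

import Mathlib

open scoped HahnSeries Cardinal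

noncomputable section

/-! ### Valued fields -/

/-- A valued field is complete, for the uniform structure induced by its valuation. -/
def ValuationComplete {F : Type*} [Field F] {Γ : Type*} [LinearOrderedAddCommGroupWithTop Γ]
    (val : AddValuation F Γ) : Prop :=
  letI : Valued F (Multiplicative Γᵒᵈ) := Valued.mk' (AddValuation.toValuation val)
  CompleteSpace F

/-- A subset of a valued field is dense, for the topology induced by the valuation. -/
def ValuationDense {F : Type*} [Field F] {Γ : Type*} [LinearOrderedAddCommGroupWithTop Γ]
    (val : AddValuation F Γ) (S : Set F) : Prop :=
  letI : Valued F (Multiplicative Γᵒᵈ) := Valued.mk' (AddValuation.toValuation val)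
  Dense S

/-- The topological closure of a subfield of a valued field, again a subfield. -/
def valuationClosure {F : Type*} [Field F] {Γ : Type*} [LinearOrderedAddCommGroupWithTop Γ]
    (val : AddValuation F Γ) (E : Subfield F) : Subfield F :=
  letI : Valued F (Multiplicative Γᵒᵈ) := Valued.mk' (AddValuation.toValuation val)
  E.topologicalClosure

theorem le_valuationClosure {F : Type*} [Field F] {Γ : Type*}
    [LinearOrderedAddCommGroupWithTop Γ] (val : AddValuation F Γ) (E : Subfield F) :
    E ≤ valuationClosure val E := by
  let _ : Valued F (Multiplicative Γᵒᵈ) := Valued.mk' (AddValuation.toValuation val)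
  exact E.le_topologicalClosure

/-- The valuation ring `{x | 0 ≤ v x}` of a valued field. -/
def valuationRing {F : Type*} [Field F] {Γ : Type*} [LinearOrderedAddCommGroupWithTop Γ]
    (val : AddValuation F Γ) : ValuationSubring F :=
  (AddValuation.toValuation val).valuationSubring

/-- Sanity check: membership in the valuation ring means having nonnegative value. -/
theorem mem_valuationRing {F : Type*} [Field F] {Γ : Type*}
    [LinearOrderedAddCommGroupWithTop Γ] (val : AddValuation F Γ) (x : F) :
    x ∈ valuationRing val ↔ 0 ≤ val x :=
  Iff.rfl

/-- A valued field is henselian if Hensel's Lemma holds for its valuation ring. -/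
def ValuationHenselian {F : Type*} [Field F] {Γ : Type*}
    [LinearOrderedAddCommGroupWithTop Γ] (val : AddValuation F Γ) : Prop :=
  HenselianLocalRing (valuationRing val)

/-- The subring `R` is an additive complement of the valuation ring `𝒪`: `R ∩ 𝒪 = {0}` and
`R + 𝒪 = F`. As `1 ∈ 𝒪`, such an `R` never contains `1`, so subrings are not required to be
unital here. -/
def IsAdditiveComplement {F : Type*} [Field F] {Γ : Type*}
    [LinearOrderedAddCommGroupWithTop Γ] (val : AddValuation F Γ)
    (R : NonUnitalSubring F) : Prop :=
  (∀ x ∈ R, x ∈ valuationRing val → x = 0) ∧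
    ∀ a : F, ∃ r ∈ R, ∃ b ∈ valuationRing val, a = r + b

/-! ### Integer parts -/

/-- An integer part of an ordered field `F`: a subring (with `1`) which is discretely ordered
(no element lies strictly between `0` and `1`) such that every `a` in `F` satisfies
`r ≤ a < r + 1` for some `r` in the subring. -/
def IsIntegerPart {F : Type*} [Field F] [LinearOrder F] (I : Subring F) : Prop :=
  (∀ r ∈ I, 0 < r → 1 ≤ r) ∧ ∀ a : F, ∃ r ∈ I, r ≤ a ∧ a < r + 1

/-! ### The field `k(G)`, its completion, and the ring `k[G^{<0}]` -/

/-- `k(G)`: the smallest subfield of the power series field `k((G))` containing all monomials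
`c t ^ g` with `c ∈ k` and `g ∈ G`. -/
def monomialField (k : Type*) (G : Type*) [Field k] [AddCommGroup G] [LinearOrder G]
    [IsOrderedAddMonoid G] : Subfield k⟦G⟧ :=
  Subfield.closure {x | ∃ (g : G) (c : k), x = HahnSeries.single g c}

/-- `k(G)^c`: the completion of `k(G)`, realized as the closure of `k(G)` in the power series
field `k((G))` with its canonical valuation. -/
def completedField (k : Type*) (G : Type*) [Field k] [AddCommGroup G] [LinearOrder G]
    [IsOrderedAddMonoid G] : Subfield k⟦G⟧ :=
  valuationClosure (HahnSeries.addVal G k) (monomialField k G)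

/-- The valuation of `k(G)^c`, sending a nonzero series to the least element of its support. -/
def completedVal (k : Type*) (G : Type*) [Field k] [AddCommGroup G] [LinearOrder G]
    [IsOrderedAddMonoid G] : AddValuation (completedField k G) (WithTop G) :=
  (HahnSeries.addVal G k).comap (completedField k G).subtype

/-- The monomial `c t ^ g` as an element of `k(G)^c`. -/
def monomialElt {k : Type*} {G : Type*} [Field k] [AddCommGroup G] [LinearOrder G]
    [IsOrderedAddMonoid G] (g : G) (c : k) : completedField k G :=
  ⟨HahnSeries.single g c,
    le_valuationClosure _ _ (Subfield.subset_closure ⟨g, c, rfl⟩)⟩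

/-- `k[G^{<0}]`: the (non-unital) subring generated by all monomials `c t ^ g` with `c ∈ k`
and `g < 0`. -/
def negativeRing (k : Type*) (G : Type*) [Field k] [AddCommGroup G] [LinearOrder G]
    [IsOrderedAddMonoid G] : NonUnitalSubring (completedField k G) :=
  NonUnitalSubring.closure {x | ∃ (g : G) (c : k), g < 0 ∧ x = monomialElt g c}

/-- The ordering of `k(G)^c` is compatible with its valuation (`0 < x ≤ y` implies
`v x ≥ v y`) and extends the ordering of the coefficient field `k`. -/
def IsCompatibleOrder (k : Type*) (G : Type*) [Field k] [LinearOrder k] [AddCommGroup G]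
    [LinearOrder G] [IsOrderedAddMonoid G] [LinearOrder (completedField k G)] : Prop :=
  (∀ x y : completedField k G, 0 < x → x ≤ y → completedVal k G y ≤ completedVal k G x) ∧
    ∀ a b : k, a < b → (monomialElt (0 : G) a) < (monomialElt (0 : G) b)

end

/-! ### Topological notions in terms of the valuation -/

section Topology

variable {F : Type*} [Field F] {Γ : Type*} [LinearOrderedAddCommGroupWithTop Γ]
  (val : AddValuation F Γ)

/-! Because `G` is archimedean, the series with finitely many exponents below every bound form a
subfield of `k((G))`. It contains the monomials and is closed, and truncations of its members are
finite sums of monomials, so it equals `k(G)^c` (`mem_completedField_iff`). Limits can then be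
formed coefficientwise, which gives completeness and, through adic completeness for principal
ideals, Hensel's Lemma. The 0/1 series on the multiples of one positive exponent make the field
uncountable.

The countability statements share one principle (`countable_of_separated`): truncations have finite
support, so there are only countably many, and a set whose distinct members never differ by an
element of positive value injects into them. Additive complements and integer parts are such sets.
The subfield such a set generates is countable, and an extension of countable transcendence degree
over a countable field is countable, so the degree here is uncountable. -/

theorem toValuation_lt_iff (x y : F) :
    AddValuation.toValuation val x < AddValuation.toValuation val y ↔ val y < val x :=
  Iff.rfl

/-- Basic neighbourhoods are indexed by units of the value group; each unit is the value of some
nonzero `z`, so balls can be indexed by field elements. -/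
theorem exists_restrict_lt_unit_iff
    (γ : (MonoidWithZeroHom.ValueGroup₀ (.ofClass (AddValuation.toValuation val)))ˣ) :
    ∃ z : F, z ≠ 0 ∧ ∀ x, (AddValuation.toValuation val).restrict x < γ.1 ↔ val z < val x := by
  obtain ⟨z, hz⟩ := MonoidWithZeroHom.ValueGroup₀.restrict₀_surjective _ γ.1
  refine ⟨z, ?_, fun x ↦ ?_⟩
  · rintro rfl
    exact γ.ne_zero (by rw [← hz, map_zero])
  · rw [← hz, ← toValuation_lt_iff, ← Valuation.restrict_lt_iff]
    rfl

theorem exists_unit_restrict_lt_iff {z : F} (hz : z ≠ 0) :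
    ∃ γ : (MonoidWithZeroHom.ValueGroup₀ (.ofClass (AddValuation.toValuation val)))ˣ,
      ∀ x, (AddValuation.toValuation val).restrict x < γ.1 ↔ val z < val x := by
  have h : (AddValuation.toValuation val).restrict z ≠ 0 := by simpa using hz
  refine ⟨Units.mk0 _ h, fun x ↦ ?_⟩
  rw [← toValuation_lt_iff, ← Valuation.restrict_lt_iff]
  rfl

theorem mem_closure_iff_exists_val_lt (S : Set F) (x : F) :
    letI : Valued F (Multiplicative Γᵒᵈ) := Valued.mk' (AddValuation.toValuation val)
    x ∈ closure S ↔ ∀ z : F, z ≠ 0 → ∃ y ∈ S, val z < val (y - x) := by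
  let _ : Valued F (Multiplicative Γᵒᵈ) := Valued.mk' (AddValuation.toValuation val)
  rw [mem_closure_iff_nhds]
  refine ⟨fun h z hz ↦ ?_, fun h t ht ↦ ?_⟩
  · obtain ⟨γ, hγ⟩ := exists_unit_restrict_lt_iff val hz
    obtain ⟨y, hy, hyS⟩ := h _ (Valued.mem_nhds.2 ⟨γ, subset_rfl⟩)
    exact ⟨y, hyS, (hγ _).1 hy⟩
  · obtain ⟨γ, hγ⟩ := Valued.mem_nhds.1 ht
    obtain ⟨z, hz, hzγ⟩ := exists_restrict_lt_unit_iff val γ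
    obtain ⟨y, hyS, hy⟩ := h z hz
    exact ⟨y, hγ ((hzγ _).2 hy), hyS⟩

theorem valuationDense_iff (S : Set F) :
    ValuationDense val S ↔ ∀ x z : F, z ≠ 0 → ∃ y ∈ S, val z < val (y - x) :=
  forall_congr' fun x ↦ mem_closure_iff_exists_val_lt val S x

theorem mem_valuationClosure_iff (E : Subfield F) (x : F) :
    x ∈ valuationClosure val E ↔ ∀ z : F, z ≠ 0 → ∃ y ∈ E, val z < val (y - x) :=
  mem_closure_iff_exists_val_lt val (E : Set F) x

theorem valuationComplete_of_forall_filter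
    (h : ∀ f : Filter F, f.NeBot →
      (∀ z : F, z ≠ 0 → ∃ M ∈ f, ∀ x ∈ M, ∀ y ∈ M, val z < val (y - x)) →
      ∃ x, ∀ z : F, z ≠ 0 → ∃ M ∈ f, ∀ y ∈ M, val z < val (y - x)) :
    ValuationComplete val := by
  let _ : Valued F (Multiplicative Γᵒᵈ) := Valued.mk' (AddValuation.toValuation val)
  refine ⟨fun {f} hf ↦ ?_⟩
  rw [Valued.cauchy_iff] at hf
  obtain ⟨x, hx⟩ := h f hf.1 fun z hz ↦ by
    obtain ⟨γ, hγ⟩ := exists_unit_restrict_lt_iff val hz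
    obtain ⟨M, hM, hMγ⟩ := hf.2 γ
    exact ⟨M, hM, fun x hx y hy ↦ (hγ _).1 (hMγ x hx y hy)⟩
  refine ⟨x, fun t ht ↦ ?_⟩
  obtain ⟨γ, hγ⟩ := Valued.mem_nhds.1 ht
  obtain ⟨z, hz, hzγ⟩ := exists_restrict_lt_unit_iff val γ
  obtain ⟨M, hM, hMz⟩ := hx z hz
  exact Filter.mem_of_superset hM fun y hy ↦ hγ ((hzγ _).2 (hMz y hy))

end Topology

/-! ### Countable subfields of uncountable fields -/

theorem aleph0_lt_trdeg_of_countable_of_uncountable (F K : Type*) [Field F] [Field K]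
    [Algebra F K] [Countable F] [Uncountable K] : ℵ₀ < Algebra.trdeg F K := by
  by_contra! h
  obtain ⟨s, hs⟩ := exists_isTranscendenceBasis F K
  have hsc : Countable s := by
    rw [← Cardinal.mk_le_aleph0_iff, hs.cardinalMk_eq_trdeg]
    exact h
  have hp : Countable (MvPolynomial s F) := by
    rw [← Cardinal.mk_le_aleph0_iff]
    refine MvPolynomial.cardinalMk_le_max_lift.trans ?_
    simp [Cardinal.mk_le_aleph0]
  have ha : Countable (Algebra.adjoin F (Set.range ((↑) : s → K))) :=
    hs.1.aevalEquiv.toEquiv.symm.injective.countable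
  have := hs.isAlgebraic
  have hK := Algebra.IsAlgebraic.cardinalMk_le_max
    (Algebra.adjoin F (Set.range ((↑) : s → K))) K
  have hK' : #K ≤ ℵ₀ := hK.trans (max_le Cardinal.mk_le_aleph0 le_rfl)
  exact not_countable (α := K) (Cardinal.mk_le_aleph0_iff.1 hK')

theorem Subfield.countable_closure {K : Type*} [Field K] {s : Set K} (hs : s.Countable) :
    Countable (Subfield.closure s) := by
  rw [← Cardinal.mk_le_aleph0_iff]
  exact (Subfield.cardinalMk_closure_le_max s).trans (max_le hs.le_aleph0 le_rfl)

/-! ### Series with finitely many exponents below every bound -/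

namespace HahnSeries

variable {k G : Type*} [Field k] [LinearOrder G]

theorem coe_lt_orderTop_iff {x : k⟦G⟧} {g : G} :
    (g : WithTop G) < x.orderTop ↔ ∀ h ≤ g, x.coeff h = 0 := by
  refine ⟨fun hx h hg ↦ coeff_eq_zero_of_lt_orderTop
    (lt_of_le_of_lt (WithTop.coe_le_coe.2 hg) hx), fun hx ↦ ?_⟩
  by_contra! hlt
  obtain ⟨o, ho⟩ := WithTop.ne_top_iff_exists.1 (ne_top_of_le_ne_top WithTop.coe_ne_top hlt)
  rw [← ho, WithTop.coe_le_coe] at hlt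
  exact coeff_orderTop_ne ho.symm (hx o hlt)

/-- A series is locally finite if its support has finitely many elements below every bound. -/
def LocallyFinite (x : k⟦G⟧) : Prop := ∀ g : G, (x.support ∩ Set.Iic g).Finite

theorem locallyFinite_of_finite {x : k⟦G⟧} (hx : x.support.Finite) : x.LocallyFinite :=
  fun _ ↦ hx.subset Set.inter_subset_left

/-- Local finiteness is a closed condition: up to `g`, the series has the same coefficients as its
approximant. -/
theorem locallyFinite_of_forall_exists {x : k⟦G⟧}
    (h : ∀ g : G, ∃ y : k⟦G⟧, y.LocallyFinite ∧ (g : WithTop G) < (y - x).orderTop) :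
    x.LocallyFinite := fun g ↦ by
  obtain ⟨y, hy, hyx⟩ := h g
  refine (hy g).subset fun a ha ↦ ⟨?_, ha.2⟩
  have := coe_lt_orderTop_iff.1 hyx a ha.2
  rw [coeff_sub, sub_eq_zero] at this
  rw [mem_support, this]
  exact ha.1

theorem LocallyFinite.add {x y : k⟦G⟧} (hx : x.LocallyFinite) (hy : y.LocallyFinite) :
    (x + y).LocallyFinite := fun g ↦
  ((hx g).union (hy g)).subset fun a ha ↦ by
    rw [← Set.union_inter_distrib_right]
    exact ⟨support_add_subset (x := x) y ha.1, ha.2⟩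

theorem LocallyFinite.neg {x : k⟦G⟧} (hx : x.LocallyFinite) : (-x).LocallyFinite := fun g ↦ by
  rw [support_neg]
  exact hx g

theorem LocallyFinite.sub {x y : k⟦G⟧} (hx : x.LocallyFinite) (hy : y.LocallyFinite) :
    (x - y).LocallyFinite := by
  rw [sub_eq_add_neg]
  exact hx.add hy.neg

theorem locallyFinite_single (g : G) (c : k) : (single g c).LocallyFinite :=
  locallyFinite_of_finite ((Set.finite_singleton g).subset support_single_subset)

theorem locallyFinite_sum {ι : Type*} (s : Finset ι) (f : ι → k⟦G⟧)
    (hf : ∀ i ∈ s, (f i).LocallyFinite) : (∑ i ∈ s, f i).LocallyFinite :=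
  Finset.sum_induction f LocallyFinite (fun _ _ ↦ LocallyFinite.add)
    (locallyFinite_of_finite (by simp)) hf

variable [AddCommGroup G]

theorem locallyFinite_one : (1 : k⟦G⟧).LocallyFinite := locallyFinite_single 0 1

variable [IsOrderedAddMonoid G]

theorem LocallyFinite.mul {x y : k⟦G⟧} (hx : x.LocallyFinite) (hy : y.LocallyFinite) :
    (x * y).LocallyFinite := fun g ↦ by
  by_cases hx0 : x = 0
  · simp [hx0]
  by_cases hy0 : y = 0
  · simp [hy0]
  refine ((hx (g - y.order)).add (hy (g - x.order))).subset ?_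
  rintro a ⟨ha, hag⟩
  obtain ⟨b, hb, c, hc, rfl⟩ := Set.mem_add.1 (support_mul_subset ha)
  have hb' : x.order ≤ b := order_le_of_coeff_ne_zero hb
  have hc' : y.order ≤ c := order_le_of_coeff_ne_zero hc
  have hag : b + c ≤ g := hag
  refine Set.add_mem_add ⟨hb, ?_⟩ ⟨hc, ?_⟩
  · exact le_sub_iff_add_le.2 ((add_le_add_right hc' b).trans hag)
  · exact le_sub_iff_add_le'.2 ((add_le_add_left hb' c).trans hag)

theorem LocallyFinite.pow {x : k⟦G⟧} (hx : x.LocallyFinite) (n : ℕ) :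
    (x ^ n).LocallyFinite := by
  induction n with
  | zero => simpa using locallyFinite_one
  | succ n ih => rw [pow_succ]; exact ih.mul hx

theorem exists_lt_nsmul_of_pos [Archimedean G] {w : WithTop G} (hw : 0 < w) (g : G) :
    ∃ n : ℕ, (g : WithTop G) < n • w := by
  cases w with
  | top => exact ⟨1, by simp⟩
  | coe a =>
    obtain ⟨n, hn⟩ := exists_lt_nsmul (WithTop.coe_pos.1 hw) g
    exact ⟨n, by rw [← WithTop.coe_nsmul]; exact WithTop.coe_lt_coe.2 hn⟩

/-- Partial sums of the geometric series approximate the inverse with error `m ^ n * (1 - m)⁻¹`,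
whose value passes every bound by the archimedean property. -/
theorem LocallyFinite.inv_one_sub [Archimedean G] {m : k⟦G⟧} (hm : m.LocallyFinite)
    (hpos : 0 < m.orderTop) : ((1 - m)⁻¹).LocallyFinite := by
  have h1 : (1 - m).orderTop = 0 := by
    have hlt : (1 : k⟦G⟧).orderTop < (-m).orderTop := by rwa [orderTop_one, orderTop_neg]
    rw [sub_eq_add_neg, orderTop_add_eq_left hlt, orderTop_one]
  have h0 : (1 - m) ≠ 0 := by
    rw [← orderTop_ne_top, h1]; exact WithTop.zero_ne_top
  refine locallyFinite_of_forall_exists fun g ↦ ?_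
  obtain ⟨n, hn⟩ := exists_lt_nsmul_of_pos hpos g
  refine ⟨∑ i ∈ Finset.range n, m ^ i, locallyFinite_sum _ _ fun i _ ↦ hm.pow i, ?_⟩
  have : ∑ i ∈ Finset.range n, m ^ i - (1 - m)⁻¹ = -(m ^ n * (1 - m)⁻¹) := by
    field_simp
    rw [mul_comm, mul_neg_geom_sum]
    ring
  have hinv : ((1 - m)⁻¹).orderTop = 0 := by
    have := orderTop_mul (1 - m) (1 - m)⁻¹
    rw [mul_inv_cancel₀ h0, h1, orderTop_one, zero_add] at this
    exact this.symm
  rw [this, orderTop_neg, orderTop_mul, hinv, add_zero]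
  exact hn.trans_le orderTop_nsmul_le_orderTop_pow

theorem LocallyFinite.inv [Archimedean G] {x : k⟦G⟧} (hx : x.LocallyFinite) :
    (x⁻¹).LocallyFinite := by
  by_cases h0 : x = 0
  · simpa [h0] using hx
  -- The inverse of the leading monomial of `x`: it normalises `x` to `1 - m` with `m` of positive
  -- value.
  set s : k⟦G⟧ := single (-x.order) (x.leadingCoeff)⁻¹ with hs
  have hs0 : s ≠ 0 := by simpa [hs] using h0
  have hpos : 0 < (1 - s * x).orderTop :=
    unit_aux x (inv_mul_cancel₀ (leadingCoeff_ne_zero.mpr h0)) _ (neg_add_cancel x.order)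
  have hslf : s.LocallyFinite := locallyFinite_single _ _
  have := (locallyFinite_one.sub (hslf.mul hx)).inv_one_sub hpos
  rw [sub_sub_cancel] at this
  have h2 := hslf.mul this
  rwa [mul_inv, ← mul_assoc, mul_inv_cancel₀ hs0, one_mul] at h2

variable (k G) in
/-- The field of locally finite series. -/
def locallyFiniteSubfield [Archimedean G] : Subfield k⟦G⟧ where
  carrier := {x | x.LocallyFinite}
  mul_mem' := LocallyFinite.mul
  one_mem' := locallyFinite_one
  add_mem' := LocallyFinite.add
  zero_mem' := locallyFinite_of_finite (by simp)
  neg_mem' := LocallyFinite.neg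
  inv_mem' _ := LocallyFinite.inv

end HahnSeries

/-! ### Truncations and coefficientwise limits -/

namespace HahnSeries

variable {k G : Type*} [Field k] [LinearOrder G]

theorem isPWO_of_forall_finite {s : Set G} (hs : ∀ g, (s ∩ Set.Iic g).Finite) : s.IsPWO := by
  rw [Set.isPWO_iff_isWF, Set.isWF_iff_no_descending_seq]
  intro f hf hmem
  refine Set.infinite_of_injective_forall_mem hf.injective (fun n ↦ ?_) (hs (f 0))
  exact ⟨hmem n, hf.antitone (Nat.zero_le n)⟩

theorem coe_le_orderTop_sub_truncLT (c : G) (x : k⟦G⟧) :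
    (c : WithTop G) ≤ (x - truncLT c x).orderTop := by
  by_contra! hlt
  obtain ⟨o, ho⟩ := WithTop.ne_top_iff_exists.1 hlt.ne_top
  rw [← ho, WithTop.coe_lt_coe] at hlt
  exact coeff_orderTop_ne ho.symm (by rw [coeff_sub, coeff_truncLT_of_lt hlt, sub_self])

theorem LocallyFinite.finite_support_truncLT {x : k⟦G⟧} (hx : x.LocallyFinite) (c : G) :
    (truncLT c x).support.Finite := by
  rw [support_truncLT]
  exact (hx c).subset fun a ha ↦ ⟨ha.1, ha.2.le⟩

theorem eq_sum_single_of_finite {x : k⟦G⟧} (hx : x.support.Finite) :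
    x = ∑ g ∈ hx.toFinset, single g (x.coeff g) := by
  ext a
  rw [coeff_sum]
  by_cases ha : x.coeff a = 0
  · rw [ha, Finset.sum_eq_zero]
    intro g _
    by_cases hag : a = g
    · rw [hag, coeff_single_same, ← hag, ha]
    · exact coeff_single_of_ne hag
  · rw [Finset.sum_eq_single a]
    · simp
    · intro g _ hag
      exact coeff_single_of_ne hag.symm
    · intro h
      simp [ha] at h

/-- A sequence of locally finite series indexed by exponents, any two members of which agree up to
the smaller index, converges to a locally finite series. -/
theorem exists_locallyFinite_limit (y : G → k⟦G⟧) (hy : ∀ g, (y g).LocallyFinite)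
    (h : ∀ g g' : G, g ≤ g' → (g : WithTop G) < (y g' - y g).orderTop) :
    ∃ x : k⟦G⟧, x.LocallyFinite ∧ ∀ g : G, (g : WithTop G) < (y g - x).orderTop := by
  -- The limit takes its coefficient at `a` from `y a`; all later members agree there.
  have hcoeff : ∀ g a, a ≤ g → (y a).coeff a = (y g).coeff a := fun g a ha ↦ by
    have := coe_lt_orderTop_iff.1 (h a g ha) a le_rfl
    rw [coeff_sub, sub_eq_zero] at this
    exact this.symm
  have hfin : ∀ g, (Function.support (fun a ↦ (y a).coeff a) ∩ Set.Iic g).Finite := fun g ↦ by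
    refine (hy g g).subset fun a ha ↦ ⟨?_, ha.2⟩
    rw [mem_support, ← hcoeff g a ha.2]
    exact ha.1
  have hwf : (Function.support (fun a ↦ (y a).coeff a)).IsPWO := isPWO_of_forall_finite hfin
  refine ⟨⟨_, hwf⟩, hfin, fun g ↦ coe_lt_orderTop_iff.2 fun a ha ↦ ?_⟩
  rw [coeff_sub, sub_eq_zero]
  exact (hcoeff g a ha).symm

end HahnSeries

open HahnSeries

/-! ### The completion as the field of locally finite series -/

section CompletedField

variable {k G : Type*} [Field k] [AddCommGroup G] [LinearOrder G] [IsOrderedAddMonoid G]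

theorem mem_monomialField_of_finite {x : k⟦G⟧} (hx : x.support.Finite) :
    x ∈ monomialField k G := by
  rw [eq_sum_single_of_finite hx]
  exact sum_mem fun g _ ↦ Subfield.subset_closure ⟨g, _, rfl⟩

theorem completedVal_monomialElt (g : G) : completedVal k G (monomialElt g 1) = g :=
  orderTop_single one_ne_zero

theorem exists_coe_eq_completedVal {z : completedField k G} (hz : z ≠ 0) :
    ∃ g : G, (g : WithTop G) = completedVal k G z :=
  WithTop.ne_top_iff_exists.1 ((AddValuation.top_iff _).not.2 hz)

theorem monomialElt_one_ne_zero (g : G) : (monomialElt g 1 : completedField k G) ≠ 0 := by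
  intro h
  have := completedVal_monomialElt (k := k) g
  rw [h, AddValuation.map_zero] at this
  exact WithTop.top_ne_coe this

variable (k G) in
theorem valuationDense_monomialField :
    ValuationDense (completedVal k G)
      {x : completedField k G | (x : k⟦G⟧) ∈ monomialField k G} := by
  rw [valuationDense_iff]
  intro x z hz
  have hx : (x : k⟦G⟧) ∈ valuationClosure (addVal G k) (monomialField k G) := x.2
  rw [mem_valuationClosure_iff] at hx
  obtain ⟨y, hy, hyx⟩ := hx z (by simpa using hz)
  exact ⟨⟨y, le_valuationClosure _ _ hy⟩, hy, hyx⟩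

variable [Archimedean G]

theorem monomialField_le_locallyFiniteSubfield :
    monomialField k G ≤ locallyFiniteSubfield k G := by
  refine Subfield.closure_le.2 ?_
  rintro _ ⟨g, c, rfl⟩
  exact locallyFinite_single g c

variable [Nontrivial G]

theorem mem_completedField_iff (x : k⟦G⟧) : x ∈ completedField k G ↔ x.LocallyFinite := by
  rw [completedField, mem_valuationClosure_iff]
  refine ⟨fun h ↦ locallyFinite_of_forall_exists fun g ↦ ?_, fun hx z hz ↦ ?_⟩
  · obtain ⟨y, hy, hyx⟩ := h (single g 1) (by simp)
    refine ⟨y, monomialField_le_locallyFiniteSubfield hy, ?_⟩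
    rwa [addVal_apply, addVal_apply, orderTop_single one_ne_zero] at hyx
  · obtain ⟨g, hg⟩ := WithTop.ne_top_iff_exists.1 (orderTop_ne_top.2 hz)
    -- Truncation at `c` gives an error of value at least `c`, so a strict bound needs `c > g`.
    obtain ⟨c, hc⟩ := exists_gt g
    refine ⟨truncLT c x, mem_monomialField_of_finite (hx.finite_support_truncLT c), ?_⟩
    rw [addVal_apply, addVal_apply, ← hg, ← orderTop_neg, neg_sub]
    exact (WithTop.coe_lt_coe.2 hc).trans_le (coe_le_orderTop_sub_truncLT c x)

theorem locallyFinite_coe (x : completedField k G) : (x : k⟦G⟧).LocallyFinite :=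
  (mem_completedField_iff _).1 x.2

theorem exists_completedField_limit (y : G → completedField k G)
    (h : ∀ g g' : G, g ≤ g' → (g : WithTop G) < completedVal k G (y g' - y g)) :
    ∃ x : completedField k G, ∀ g : G, (g : WithTop G) < completedVal k G (y g - x) := by
  obtain ⟨x, hx, hxy⟩ := exists_locallyFinite_limit (fun g ↦ (y g : k⟦G⟧))
    (fun g ↦ locallyFinite_coe _) h
  exact ⟨⟨x, (mem_completedField_iff x).2 hx⟩, hxy⟩

variable (k G) in
theorem valuationComplete_completedVal : ValuationComplete (completedVal k G) := by
  refine valuationComplete_of_forall_filter _ fun f hf hc ↦ ?_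
  have hc' : ∀ g : G, ∃ M ∈ f, ∀ x ∈ M, ∀ y ∈ M, (g : WithTop G) < completedVal k G (y - x) :=
    fun g ↦ by
      have := hc (monomialElt g 1) (monomialElt_one_ne_zero g)
      rwa [completedVal_monomialElt] at this
  choose M hM hMv using hc'
  choose y hy using fun g ↦ f.nonempty_of_mem (hM g)
  obtain ⟨x, hx⟩ := exists_completedField_limit y fun g g' hg ↦ by
    -- A common point of the two Cauchy sets links their chosen representatives.
    obtain ⟨w, hw, hw'⟩ := f.nonempty_of_mem (f.inter_sets (hM g) (hM g'))
    have h1 := hMv g _ (hy g) _ hw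
    have h2 := (WithTop.coe_le_coe.2 hg).trans_lt (hMv g' _ hw' _ (hy g'))
    have := AddValuation.map_lt_add _ h2 h1
    rwa [sub_add_sub_cancel] at this
  refine ⟨x, fun z hz ↦ ?_⟩
  obtain ⟨g, hg⟩ := exists_coe_eq_completedVal hz
  refine ⟨M g, hM g, fun w hw ↦ ?_⟩
  have := AddValuation.map_lt_add _ (hMv g _ (hy g) _ hw) (hx g)
  rwa [sub_add_sub_cancel, hg] at this

variable (k G) in
theorem uncountable_completedField : Uncountable (completedField k G) := by
  obtain ⟨a, ha⟩ := exists_zero_lt (α := G)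
  have hinj : Function.Injective (fun n : ℕ ↦ n • a) := (nsmul_left_strictMono ha).injective
  classical
  let c : (Set ℕ) → G → k := fun s g ↦ if ∃ n ∈ s, n • a = g then 1 else 0
  have hfin : ∀ s g, (Function.support (c s) ∩ Set.Iic g).Finite := fun s g ↦ by
    obtain ⟨N, hN⟩ := exists_lt_nsmul ha g
    refine ((Set.finite_lt_nat N).image (fun n ↦ n • a)).subset ?_
    rintro x ⟨hx, hxg⟩
    have : ∃ n ∈ s, n • a = x := by
      by_contra h
      exact hx (if_neg h)
    obtain ⟨n, -, rfl⟩ := this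
    exact ⟨n, (nsmul_left_strictMono ha).lt_iff_lt.1 (lt_of_le_of_lt hxg hN), rfl⟩
  let x : Set ℕ → k⟦G⟧ := fun s ↦ ⟨c s, isPWO_of_forall_finite (hfin s)⟩
  have hx : ∀ s, (x s).LocallyFinite := hfin
  have hxi : Function.Injective
      (fun s ↦ (⟨x s, (mem_completedField_iff _).2 (hx s)⟩ : completedField k G)) := by
    intro s t hst
    have hct : c s = c t := congrArg (fun y : completedField k G ↦ (y : k⟦G⟧).coeff) hst
    ext n
    have := congrFun hct (n • a)
    have hs : ∀ u : Set ℕ, (∃ m ∈ u, m • a = n • a) ↔ n ∈ u := fun u ↦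
      ⟨fun ⟨m, hm, h⟩ ↦ hinj h ▸ hm, fun h ↦ ⟨n, h, rfl⟩⟩
    simp only [c, hs] at this
    by_cases h1 : n ∈ s <;> by_cases h2 : n ∈ t <;> simp_all
  have : Uncountable (Set ℕ) := by
    rw [← Cardinal.aleph0_lt_mk_iff]
    simpa using Cardinal.cantor ℵ₀
  exact hxi.uncountable

/-! ### Countability of subsets with separated elements -/

/-- A set of series, any two distinct elements of which differ by an element of nonpositive value,
is countable. -/
theorem countable_of_separated [Countable k] [Countable G] (S : Set (completedField k G))
    (hS : ∀ x ∈ S, ∀ y ∈ S, 0 < completedVal k G (x - y) → x = y) : S.Countable := by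
  -- Truncating at `0` would only make the difference integral; a cut at `a > 0` makes its value
  -- positive.
  obtain ⟨a, ha⟩ := exists_zero_lt (α := G)
  have hfin (x : completedField k G) := (locallyFinite_coe x).finite_support_truncLT a
  let F : S → (G →₀ k) := fun x ↦ Finsupp.ofSupportFinite _ (hfin x)
  have hF : Function.Injective F := by
    rintro ⟨x, hx⟩ ⟨y, hy⟩ hxy
    have hxy' : truncLT a (x : k⟦G⟧) = truncLT a (y : k⟦G⟧) :=
      HahnSeries.ext (congrArg (fun f : G →₀ k ↦ (f : G → k)) hxy)
    refine Subtype.ext (hS x hx y hy ?_)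
    have h1 := coe_le_orderTop_sub_truncLT a ((x : k⟦G⟧) - (y : k⟦G⟧))
    rw [show truncLT a ((x : k⟦G⟧) - (y : k⟦G⟧)) = 0 by
      ext g
      have := congrArg (fun f : k⟦G⟧ ↦ f.coeff g) hxy'
      simp only [HahnSeries.coeff_truncLT, coeff_sub, coeff_zero] at this ⊢
      split_ifs at this ⊢ with hg
      · rw [this, sub_self]
      · rfl, sub_zero] at h1
    exact (WithTop.coe_pos.2 ha).trans_le h1
  exact Set.countable_coe_iff.1 hF.countable

end CompletedField

/-! ### The henselian property -/

section Henselian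

variable {F : Type*} [Field F] {Γ : Type*} [LinearOrderedAddCommGroupWithTop Γ]
  (val : AddValuation F Γ)

theorem valuationRing_dvd_iff {a b : valuationRing val} : a ∣ b ↔ val (a : F) ≤ val (b : F) := by
  constructor
  · rintro ⟨c, rfl⟩
    have hc : 0 ≤ val (c : F) := c.2
    simpa [AddValuation.map_mul] using add_le_add_right hc (val (a : F))
  · intro h
    by_cases ha : (a : F) = 0
    · rw [ha, AddValuation.map_zero, top_le_iff, AddValuation.top_iff] at h
      have : b = 0 := Subtype.ext h
      simp [this]
    · have hta : val (a : F) ≠ ⊤ := (AddValuation.top_iff _).not.2 ha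
      have hmul : (a : F) * ((a : F)⁻¹ * b) = b := mul_inv_cancel_left₀ ha _
      refine ⟨⟨(a : F)⁻¹ * b, ?_⟩, Subtype.ext hmul.symm⟩
      change 0 ≤ val ((a : F)⁻¹ * b)
      by_contra! hlt
      have := AddValuation.map_mul val (a : F) ((a : F)⁻¹ * b)
      rw [hmul] at this
      rw [this] at h
      have h2 : val (a : F) + val ((a : F)⁻¹ * b) < val (a : F) + 0 :=
        (add_lt_add_iff_right_of_ne_top hta).2 hlt
      rw [add_zero] at h2
      exact absurd h h2.not_ge

theorem smodEq_span_singleton_pow_iff {b x y : valuationRing val} {n : ℕ} :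
    x ≡ y [SMOD ((Ideal.span {b}) ^ n • ⊤ : Submodule (valuationRing val) (valuationRing val))] ↔
      n • val (b : F) ≤ val ((x : F) - y) := by
  rw [SModEq.sub_mem, smul_eq_mul, Ideal.mul_top, Ideal.span_singleton_pow,
    Ideal.mem_span_singleton, valuationRing_dvd_iff]
  simp [AddValuation.map_pow]

theorem mem_maximalIdeal_valuationRing_iff (x : valuationRing val) :
    x ∈ IsLocalRing.maximalIdeal (valuationRing val) ↔ 0 < val (x : F) := by
  have hx : 0 ≤ val (x : F) := x.2
  rw [IsLocalRing.mem_maximalIdeal, mem_nonunits_iff, isUnit_iff_dvd_one, valuationRing_dvd_iff]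
  simp

/-- If the valuation ring is adically complete for every principal ideal generated by a nonzero
nonunit, then the valued field is henselian. -/
theorem valuationHenselian_of_isAdicComplete
    (h : ∀ b : valuationRing val, 0 < val (b : F) → b ≠ 0 →
      IsAdicComplete (Ideal.span {b}) (valuationRing val)) :
    ValuationHenselian val where
  is_henselian f hf a₀ h₁ h₂ := by
    -- Hensel's Lemma is applied to the ideal generated by `f.eval a₀`. The maximal ideal would not
    -- do: for a dense value group it equals its square.
    by_cases h0 : f.eval a₀ = 0
    · exact ⟨a₀, h0, by simp⟩
    have := h _ ((mem_maximalIdeal_valuationRing_iff val _).1 h₁) h0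
    obtain ⟨a, ha, haa⟩ := HenselianRing.is_henselian (I := Ideal.span {f.eval a₀}) f hf a₀
      (Ideal.mem_span_singleton_self _) (h₂.map _)
    exact ⟨a, ha, (Ideal.span_singleton_le_iff_mem _).2 h₁ haa⟩

end Henselian

/-! ### The negative ring and adic completeness -/

section CompletedField

variable (k G : Type*) [Field k] [AddCommGroup G] [LinearOrder G] [IsOrderedAddMonoid G]

theorem support_of_mem_negativeRing {x : completedField k G} (hx : x ∈ negativeRing k G) :
    (x : k⟦G⟧).support ⊆ Set.Iio 0 := by
  induction hx using NonUnitalSubring.closure_induction with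
  | mem x hx =>
    obtain ⟨g, c, hg, rfl⟩ := hx
    exact support_single_subset.trans (Set.singleton_subset_iff.2 hg)
  | zero => simp
  | add x y _ _ hx hy =>
    exact (support_add_subset (x := (x : k⟦G⟧)) (y : k⟦G⟧)).trans (Set.union_subset hx hy)
  | neg x _ hx => simpa using hx
  | mul x y _ _ hx hy =>
    refine (support_mul_subset (x := (x : k⟦G⟧)) (y := (y : k⟦G⟧))).trans ?_
    rintro _ ⟨a, ha, b, hb, rfl⟩
    exact add_neg (hx ha) (hy hb)

theorem mem_negativeRing_of_support {x : completedField k G} (hfin : (x : k⟦G⟧).support.Finite)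
    (hx : (x : k⟦G⟧).support ⊆ Set.Iio 0) : x ∈ negativeRing k G := by
  have : x = ∑ g ∈ hfin.toFinset, monomialElt g ((x : k⟦G⟧).coeff g) := by
    refine Subtype.ext ?_
    rw [AddSubmonoidClass.coe_finsetSum]
    exact eq_sum_single_of_finite hfin
  rw [this]
  exact sum_mem fun g hg ↦ NonUnitalSubring.subset_closure
    ⟨g, _, hx (hfin.mem_toFinset.1 hg), rfl⟩

variable [Archimedean G] [Nontrivial G]

/-- The multiples of the value of `b` are cofinal in `G`, so the `b`-adic and valuation topologies
agree. -/
theorem isAdicComplete_valuationRing_completedVal (b : valuationRing (completedVal k G))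
    (hb : 0 < completedVal k G b) (hb0 : b ≠ 0) :
    IsAdicComplete (Ideal.span {b}) (valuationRing (completedVal k G)) where
  haus' x hx := by
    by_contra hx0
    obtain ⟨g, hg⟩ := exists_coe_eq_completedVal (z := (x : completedField k G)) (by simpa using hx0)
    obtain ⟨n, hn⟩ := exists_lt_nsmul_of_pos hb g
    have := (smodEq_span_singleton_pow_iff _).1 (hx n)
    rw [ZeroMemClass.coe_zero, sub_zero, ← hg] at this
    exact hn.not_ge this
  prec' f hf := by
    choose N hN using fun g : G ↦ exists_lt_nsmul_of_pos hb g
    have hdist : ∀ (g : G) (m n : ℕ), (g : WithTop G) < m • completedVal k G b →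
        (g : WithTop G) < n • completedVal k G b →
        (g : WithTop G) < completedVal k G ((f m : completedField k G) - f n) := by
      intro g m n hm hn
      rcases le_total m n with hmn | hmn
      · exact hm.trans_le ((smodEq_span_singleton_pow_iff _).1 (hf hmn))
      · rw [AddValuation.map_sub_swap]
        exact hn.trans_le ((smodEq_span_singleton_pow_iff _).1 (hf hmn))
    obtain ⟨x, hx⟩ := exists_completedField_limit (fun g ↦ (f (N g) : completedField k G))
      fun g g' hg ↦ hdist g _ _ ((WithTop.coe_le_coe.2 hg).trans_lt (hN g')) (hN g)
    have hx0 : x ∈ valuationRing (completedVal k G) := by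
      rw [← sub_sub_cancel (f (N 0) : completedField k G) x]
      exact sub_mem (f (N 0)).2 (hx 0).le
    refine ⟨⟨x, hx0⟩, fun n ↦ (smodEq_span_singleton_pow_iff _).2 ?_⟩
    obtain ⟨β, hβ⟩ := exists_coe_eq_completedVal (z := (b : completedField k G)) (by simpa using hb0)
    have h1 : n • completedVal k G b = ((n • β : G) : WithTop G) := by rw [← hβ, WithTop.coe_nsmul]
    -- This places `f (N (n • β))` beyond index `n`, so it is close both to `f n` and to the limit.
    have hNn : n ≤ N (n • β) := by
      have h := hN (n • β)
      rw [← hβ, ← WithTop.coe_nsmul, WithTop.coe_lt_coe] at h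
      rw [← hβ, WithTop.coe_pos] at hb
      exact ((nsmul_left_strictMono hb).lt_iff_lt.1 h).le
    have h2 := (smodEq_span_singleton_pow_iff _).1 (hf hNn)
    have h3 := (hx (n • β)).le
    rw [← h1] at h3
    have := AddValuation.map_le_add _ h2 h3
    rwa [sub_add_sub_cancel] at this

theorem valuationHenselian_completedVal : ValuationHenselian (completedVal k G) :=
  valuationHenselian_of_isAdicComplete _ (isAdicComplete_valuationRing_completedVal k G)

/-! ### Additive complements and integer parts -/

/-- Each series is cut at exponent `0`; local finiteness makes the negative part a finite sum of
monomials. -/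
theorem isAdditiveComplement_negativeRing :
    IsAdditiveComplement (completedVal k G) (negativeRing k G) := by
  refine ⟨fun x hx hx0 ↦ ?_, fun x ↦ ?_⟩
  · by_contra hne
    obtain ⟨g, hg⟩ := exists_coe_eq_completedVal hne
    rw [mem_valuationRing, ← hg, WithTop.coe_nonneg] at hx0
    exact absurd (support_of_mem_negativeRing k G hx (coeff_orderTop_ne hg.symm)) hx0.not_gt
  · have hfin := (locallyFinite_coe x).finite_support_truncLT 0
    let r : completedField k G :=
      ⟨truncLT 0 (x : k⟦G⟧), (mem_completedField_iff _).2 (locallyFinite_of_finite hfin)⟩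
    refine ⟨r, mem_negativeRing_of_support k G hfin ?_, x - r, ?_, (add_sub_cancel _ _).symm⟩
    · rw [support_truncLT]
      exact fun a ha ↦ ha.2
    · exact coe_le_orderTop_sub_truncLT 0 (x : k⟦G⟧)

variable {k G}

theorem countable_of_isAdditiveComplement [Countable k] [Countable G]
    {R : NonUnitalSubring (completedField k G)}
    (hR : IsAdditiveComplement (completedVal k G) R) : (R : Set (completedField k G)).Countable :=
  countable_of_separated _ fun _ hx _ hy hxy ↦
    sub_eq_zero.1 (hR.1 _ (sub_mem hx hy) hxy.le)

/-- A positive element of `I` is at least `1`, so by compatibility its value is at most `0`. Hence a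
difference of positive value has neither sign. -/
theorem countable_of_isIntegerPart [Countable k] [Countable G]
    [LinearOrder (completedField k G)] [IsStrictOrderedRing (completedField k G)]
    (hord : ∀ x y : completedField k G, 0 < x → x ≤ y → completedVal k G y ≤ completedVal k G x)
    {I : Subring (completedField k G)} (hI : IsIntegerPart I) :
    (I : Set (completedField k G)).Countable := by
  have hnot : ∀ r ∈ I, 0 < completedVal k G r → ¬ 0 < r := fun r hr hv hpos ↦ by
    have := hord 1 r one_pos (hI.1 r hr hpos)
    rw [AddValuation.map_one] at this
    exact hv.not_ge this
  refine countable_of_separated _ fun x hx y hy hxy ↦ le_antisymm ?_ ?_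
  · exact sub_nonpos.1 (not_lt.1 (hnot _ (sub_mem hx hy) hxy))
  · rw [AddValuation.map_sub_swap] at hxy
    exact sub_nonpos.1 (not_lt.1 (hnot _ (sub_mem hy hx) hxy))

theorem countable_closure_and_aleph0_lt_trdeg {S : Set (completedField k G)} (hS : S.Countable) :
    Countable (Subfield.closure S) ∧
      ℵ₀ < Algebra.trdeg (Subfield.closure S) (completedField k G) := by
  have hc := Subfield.countable_closure hS
  have := uncountable_completedField k G
  exact ⟨hc, aleph0_lt_trdeg_of_countable_of_uncountable _ _⟩

end CompletedField

theorem mainTheorem8 {k : Type*} {G : Type*} [Field k] [Countable k]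
    [AddCommGroup G] [LinearOrder G] [IsOrderedAddMonoid G] [Archimedean G]
    [Countable G] [Nontrivial G] :
    -- `k(G)^c` is the completion of `k(G)`, and it is an uncountable henselian field
    (ValuationComplete (completedVal k G) ∧
      ValuationDense (completedVal k G)
        {x : completedField k G | (x : k⟦G⟧) ∈ monomialField k G} ∧
      Uncountable (completedField k G) ∧
      ValuationHenselian (completedVal k G)) ∧
    -- `k[G^{<0}]` is a countable additive complement of its valuation ring
    (Countable (negativeRing k G) ∧
      IsAdditiveComplement (completedVal k G) (negativeRing k G)) ∧
    -- arbitrary additive complements, with `Quot R` the subfield generated by `R`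
    (∀ R : NonUnitalSubring (completedField k G),
      IsAdditiveComplement (completedVal k G) R →
        Countable (Subfield.closure (R : Set (completedField k G))) ∧
        ℵ₀ < Algebra.trdeg (Subfield.closure (R : Set (completedField k G)))
          (completedField k G)) ∧
    -- arbitrary integer parts, if `k` is ordered
    (∀ [LinearOrder k] [IsStrictOrderedRing k]
      [LinearOrder (completedField k G)] [IsStrictOrderedRing (completedField k G)],
      IsCompatibleOrder k G →
      ∀ I : Subring (completedField k G), IsIntegerPart I →
        Countable (Subfield.closure (I : Set (completedField k G))) ∧
        ℵ₀ < Algebra.trdeg (Subfield.closure (I : Set (completedField k G)))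
          (completedField k G)) := by
  refine ⟨⟨valuationComplete_completedVal k G, valuationDense_monomialField k G,
    uncountable_completedField k G, valuationHenselian_completedVal k G⟩,
    ⟨(countable_of_isAdditiveComplement (isAdditiveComplement_negativeRing k G)).to_subtype,
      isAdditiveComplement_negativeRing k G⟩,
    fun R hR ↦ countable_closure_and_aleph0_lt_trdeg (countable_of_isAdditiveComplement hR), ?_⟩
  intro _ _ _ _ hord I hI
  exact countable_closure_and_aleph0_lt_trdeg (countable_of_isIntegerPart hord.1 hI)
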